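/- A polytope in $\mathbb{R}^n$ is the convex hull of a finite set, and a polyhedron in $\mathbb{R}^n$ is a finite (possibly empty) union of polytopes. The dimension $\dim P$ of a nonempty polyhedron $P$ is the largest $k$ such that $P$ contains a $k$-simplex (the convex hull of $k+1$ affinely independent points). For a polyhedron $P\subseteq\mathbb{R}^n$ let $\mathrm{Sub}_o(P)$ be the set of all $O\subseteq P$ such that $P\setminus O$ is a polyhedron. Ordered by inclusion it is a Heyting algebra, with joins given by unions, meets by intersections, bottom $\emptyset$, top $P$, and implication $U\to V = P\setminus \mathrm{cl}(U\setminus V)$, that is, the interior in $P$ of $(P\setminus U)\cup V$. The bounded-depth formulas over propositional variables $\alpha_0,\alpha_1,\dots$ are defined by $\mathrm{BD}_0=\alpha_0\vee\neg\alpha_0$ and $\mathrm{BD}_d=\alpha_d\vee(\alpha_d\to \mathrm{BD}_{d-1})$ for $d\ge 1$. A Heyting algebra satisfies the equation $\mathrm{BD}_d=\top$ if $\mathrm{BD}_d$ takes the value $\top$ under every assignment of elements of the algebra to the variables, and fails it otherwise. Theorem. Let $n\in\mathbb{N}$, let $\emptyset\neq P\subseteq\mathbb{R}^n$ be a polyhedron,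 and let $d\in\mathbb{N}$. The following are equivalent. (i) $\dim P=d$. (ii) The Heyting algebra $\mathrm{Sub}_o(P)$ satisfies the equation $\mathrm{BD}_d=\top$, and fails the equation $\mathrm{BD}_{d'}=\top$ for each integer $0\le d'<d$. -/

import Mathlib

namespace OpenPolyhedra

open Set
open scoped Pointwise

/-! ### Propositional formulas, the bounded-depth formulas, and their Heyting semantics -/

/-- Propositional formulas over the propositions `α₀, α₁, α₂, …`. -/
inductive Formula : Type
  | var : ℕ → Formula
  | bot : Formula
  | and : Formula → Formula → Formula
  | or : Formula → Formula → Formula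
  | imp : Formula → Formula → Formula

/-- Negation `¬ φ`, i.e. `φ → ⊥`. -/
def Formula.neg (φ : Formula) : Formula := Formula.imp φ Formula.bot

/-- The bounded-depth formulas: `bd 0 = α₀ ∨ ¬ α₀` and
`bd (d + 1) = α_{d+1} ∨ (α_{d+1} → bd d)`. -/
def Formula.bd : ℕ → Formula
  | 0 => Formula.or (Formula.var 0) (Formula.neg (Formula.var 0))
  | d + 1 => Formula.or (Formula.var (d + 1)) (Formula.imp (Formula.var (d + 1)) (Formula.bd d))

/-- The value of a formula in a Heyting algebra under a valuation of the propositions. -/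
def Formula.eval {H : Type*} [HeytingAlgebra H] (v : ℕ → H) : Formula → H
  | Formula.var i => v i
  | Formula.bot => ⊥
  | Formula.and φ ψ => φ.eval v ⊓ ψ.eval v
  | Formula.or φ ψ => φ.eval v ⊔ ψ.eval v
  | Formula.imp φ ψ => φ.eval v ⇨ ψ.eval v

/-- The Heyting algebra `H` satisfies the equation `φ = ⊤`. -/
def Satisfies (H : Type*) [HeytingAlgebra H] (φ : Formula) : Prop :=
  ∀ v : ℕ → H, φ.eval v = ⊤

/-! ### Polytopes, polyhedra and dimension -/

/-- A polytope is the convex hull of a finite set (possibly empty). -/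
def IsPolytope {E : Type*} [AddCommGroup E] [Module ℝ E] (S : Set E) : Prop :=
  ∃ V : Set E, V.Finite ∧ S = convexHull ℝ V

/-- A (compact) polyhedron is a finite union of polytopes; the empty union is allowed. -/
def IsPolyhedron {E : Type*} [AddCommGroup E] [Module ℝ E] (P : Set E) : Prop :=
  ∃ C : Set (Set E), C.Finite ∧ (∀ S ∈ C, IsPolytope S) ∧ P = ⋃₀ C

/-- The dimension of a subset of a real vector space: the supremum of all `k` such that the set
contains a `k`-simplex (the convex hull of `k + 1` affinely independent points). It is `⊥` for
the empty set; in finite dimension the supremum over a nonempty set is a maximum. -/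
noncomputable def polyDim {E : Type*} [AddCommGroup E] [Module ℝ E] (P : Set E) : WithBot ℕ∞ :=
  ⨆ k ∈ {k : ℕ | ∃ σ : Affine.Simplex ℝ E k, convexHull ℝ (range σ.points) ⊆ P},
    (((k : ℕ) : ℕ∞) : WithBot ℕ∞)

/-! ### Closure properties of polyhedra -/

section Algebraic

variable {E : Type*} [AddCommGroup E] [Module ℝ E]

theorem IsPolyhedron.biUnion {ι : Type*} {s : Set ι} (hs : s.Finite) {f : ι → Set E}
    (h : ∀ i ∈ s, IsPolyhedron (f i)) : IsPolyhedron (⋃ i ∈ s, f i) := by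
  choose! C hC hC' hP using h
  refine ⟨⋃ i ∈ s, C i, hs.biUnion hC, ?_, ?_⟩
  · intro S hS
    simp only [mem_iUnion] at hS
    obtain ⟨i, hi, hS⟩ := hS
    exact hC' i hi S hS
  · ext x
    simp only [mem_iUnion, mem_sUnion]
    constructor
    · rintro ⟨i, hi, hx⟩
      rw [hP i hi] at hx
      obtain ⟨S, hS, hxS⟩ := hx
      exact ⟨S, ⟨i, hi, hS⟩, hxS⟩
    · rintro ⟨S, ⟨i, hi, hS⟩, hxS⟩
      refine ⟨i, hi, ?_⟩
      rw [hP i hi]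
      exact ⟨S, hS, hxS⟩

theorem IsPolytope.isPolyhedron {S : Set E} (h : IsPolytope S) : IsPolyhedron S :=
  ⟨{S}, finite_singleton S, by simpa using h, by simp⟩

theorem isPolytope_empty : IsPolytope (∅ : Set E) := ⟨∅, finite_empty, by simp⟩

theorem isPolyhedron_empty : IsPolyhedron (∅ : Set E) := isPolytope_empty.isPolyhedron

theorem IsPolyhedron.union {A B : Set E} (hA : IsPolyhedron A) (hB : IsPolyhedron B) :
    IsPolyhedron (A ∪ B) := by
  obtain ⟨C, hC, hC', rfl⟩ := hA
  obtain ⟨D, hD, hD', rfl⟩ := hB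
  refine ⟨C ∪ D, hC.union hD, ?_, (sUnion_union C D).symm⟩
  rintro S (hS | hS)
  · exact hC' S hS
  · exact hD' S hS

theorem convex_homogenization {C : Set E} (hC : Convex ℝ C) :
    Convex ℝ {p : ℝ × E | 0 < p.1 ∧ p.2 ∈ p.1 • C} := by
  rintro ⟨s, x⟩ ⟨hs, hx⟩ ⟨t, y⟩ ⟨ht, hy⟩ a b ha hb hab
  simp only at hs hx ht hy
  have hpos : 0 < a * s + b * t := by
    rcases ha.eq_or_lt with rfl | ha'
    · have : b = 1 := by linarith
      subst this
      linarith
    · have := mul_pos ha' hs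
      have := mul_nonneg hb ht.le
      linarith
  refine ⟨by simpa using hpos, ?_⟩
  simp only [Prod.smul_mk, Prod.mk_add_mk, smul_eq_mul]
  rw [hC.add_smul (mul_nonneg ha hs.le) (mul_nonneg hb ht.le), mul_smul, mul_smul]
  exact Set.add_mem_add (Set.smul_mem_smul_set hx) (Set.smul_mem_smul_set hy)

/-- A polytope cut by a closed half-space is a polytope. -/
theorem IsPolytope.inter_halfspace {K : Set E} (hK : IsPolytope K) (f : E →ₗ[ℝ] ℝ) (c : ℝ) :
    IsPolytope {x ∈ K | f x ≤ c} := by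
  obtain ⟨V, hV, rfl⟩ := hK
  let A : Set E := {v ∈ V | f v ≤ c}
  let B : Set E := {v ∈ V | c < f v}
  let z : E × E → E := fun p =>
    (f p.2 - f p.1)⁻¹ • ((f p.2 - c) • p.1 + (c - f p.1) • p.2)
  have hA : A.Finite := hV.subset (sep_subset _ _)
  have hB : B.Finite := hV.subset (sep_subset _ _)
  have hVAB : V = A ∪ B := by
    ext v
    simp only [A, B, mem_union, mem_ofPred_eq]
    constructor
    · intro hv
      rcases le_or_gt (f v) c with h | h
      · exact Or.inl ⟨hv, h⟩
      · exact Or.inr ⟨hv, h⟩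
    · rintro (h | h) <;> exact h.1
  have hAc : convexHull ℝ A ⊆ {x | f x ≤ c} :=
    convexHull_min (fun x hx => hx.2) (convex_halfSpace_le f.isLinear c)
  have hBc : convexHull ℝ B ⊆ {x | c < f x} :=
    convexHull_min (fun x hx => hx.2) (convex_halfSpace_gt f.isLinear c)
  have hABV : convexHull ℝ A ⊆ convexHull ℝ V := convexHull_mono (sep_subset _ _)
  have hBV : convexHull ℝ B ⊆ convexHull ℝ V := convexHull_mono (sep_subset _ _)
  refine ⟨A ∪ z '' (A ×ˢ B), hA.union ((hA.prod hB).image z), Subset.antisymm ?_ ?_⟩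
  · rintro x ⟨hx, hxc⟩
    set C := convexHull ℝ (A ∪ z '' (A ×ˢ B)) with hCdef
    have hC : Convex ℝ C := convex_convexHull ℝ _
    have hAC : convexHull ℝ A ⊆ C := convexHull_mono subset_union_left
    rcases B.eq_empty_or_nonempty with hBe | hBne
    · rw [hVAB, hBe, union_empty] at hx
      exact hAC hx
    rcases A.eq_empty_or_nonempty with hAe | hAne
    · rw [hVAB, hAe, empty_union] at hx
      exact absurd (hBc hx) (not_lt.2 hxc)
    let D : Set (ℝ × E) := {p : ℝ × E | 0 < p.1 ∧ p.2 ∈ p.1 • C}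
    have hD : Convex ℝ D := convex_homogenization hC
    let F : E → E → ℝ × E := fun a b => (f b - f a, (f b - c) • a + (c - f a) • b)
    have h0 : ∀ a ∈ A, ∀ b ∈ B, F a b ∈ D := by
      intro a ha b hb
      have hpos : 0 < f b - f a := by
        have h1 := ha.2
        have h2 := hb.2
        linarith
      refine ⟨hpos, ⟨z (a, b), subset_convexHull ℝ _ (Or.inr ⟨(a, b), ⟨ha, hb⟩, rfl⟩), ?_⟩⟩
      simp only [z, F]
      rw [smul_smul, mul_inv_cancel₀ hpos.ne', one_smul]
    have h1 : ∀ b ∈ B, convexHull ℝ A ⊆ {a | F a b ∈ D} := by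
      intro b hb
      refine convexHull_min (fun a ha => h0 a ha b hb) ?_
      intro a ha a' ha' s t hs ht hst
      have h := hD ha ha' hs ht hst
      have e : s • F a b + t • F a' b = F (s • a + t • a') b := by
        have hs' : s = 1 - t := by linarith
        subst hs'
        ext
        · simp [F]
          ring
        · simp [F]
          module
      rw [e] at h
      exact h
    have h2 : ∀ a ∈ convexHull ℝ A, convexHull ℝ B ⊆ {b | F a b ∈ D} := by
      intro a ha
      refine convexHull_min (fun b hb => h1 b hb ha) ?_
      intro b hb b' hb' s t hs ht hst
      have h := hD hb hb' hs ht hst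
      have e : s • F a b + t • F a b' = F a (s • b + t • b') := by
        have hs' : s = 1 - t := by linarith
        subst hs'
        ext
        · simp [F]
          ring
        · simp [F]
          module
      rw [e] at h
      exact h
    rw [hVAB, convexHull_union hAne hBne, mem_convexJoin] at hx
    obtain ⟨a, ha, b, hb, s, t, hs, ht, hst, rfl⟩ := hx
    obtain ⟨hpos, y, hy, hyeq⟩ := h2 a ha hb
    have hac : f a ≤ c := hAc ha
    have hbc : c < f b := hBc hb
    simp only [F] at hpos hyeq
    have hs' : s = 1 - t := by linarith
    subst hs'
    simp only [map_add, map_smul, smul_eq_mul] at hxc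
    rcases hac.eq_or_lt with hac' | hac'
    · have ht0 : t = 0 := by
        subst hac'
        by_contra hne
        have : 0 < t := lt_of_le_of_ne ht (Ne.symm hne)
        nlinarith
      subst ht0
      simpa using hAC ha
    · have hq : 0 < c - f a := by linarith
      have key : (1 - t) • a + t • b
          = (1 - t * (f b - f a) / (c - f a)) • a + (t * (f b - f a) / (c - f a)) • y := by
        have e1 : (t * (f b - f a) / (c - f a)) • y
            = (t / (c - f a)) • ((f b - c) • a + (c - f a) • b) := by
          rw [← hyeq]
          simp only [smul_smul]
          congr 1
          ring
        rw [e1, smul_add, smul_smul, smul_smul, div_mul_cancel₀ _ hq.ne', ← add_assoc,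
          ← add_smul]
        congr 2
        field_simp
        ring
      rw [key]
      refine hC (hAC ha) hy ?_ ?_ (by ring)
      · rw [sub_nonneg, div_le_one hq]
        nlinarith
      · exact div_nonneg (mul_nonneg ht hpos.le) hq.le
  · refine convexHull_min ?_ ?_
    · rintro x (hx | ⟨⟨a, b⟩, ⟨ha, hb⟩, rfl⟩)
      · exact ⟨subset_convexHull ℝ _ hx.1, hx.2⟩
      · have h1 : f a ≤ c := ha.2
        have h2 : c < f b := hb.2
        have hpos : 0 < f b - f a := by linarith
        have e : z (a, b) = ((f b - c) / (f b - f a)) • a + ((c - f a) / (f b - f a)) • b := by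
          simp only [z]
          rw [smul_add, smul_smul, smul_smul, inv_mul_eq_div, inv_mul_eq_div]
        refine ⟨?_, ?_⟩
        · rw [e]
          refine convex_convexHull ℝ V (subset_convexHull ℝ _ ha.1) (subset_convexHull ℝ _ hb.1)
            (div_nonneg (by linarith) hpos.le) (div_nonneg (by linarith) hpos.le) ?_
          field_simp
          ring
        · rw [e]
          simp only [map_add, map_smul, smul_eq_mul]
          apply le_of_eq
          field_simp
          ring
    · exact (convex_convexHull ℝ V).inter (convex_halfSpace_le f.isLinear c)

/-- A polytope cut by finitely many closed half-spaces is a polytope. -/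
theorem IsPolytope.inter_halfspaces {K : Set E} (hK : IsPolytope K)
    {G : Set ((E →ₗ[ℝ] ℝ) × ℝ)} (hG : G.Finite) :
    IsPolytope {x ∈ K | ∀ g ∈ G, g.1 x ≤ g.2} := by
  induction G, hG using Set.Finite.induction_on with
  | empty => simpa using hK
  | @insert g G _ _ ih =>
    have e : {x ∈ K | ∀ g' ∈ insert g G, g'.1 x ≤ g'.2}
        = {x ∈ {x ∈ K | ∀ g ∈ G, g.1 x ≤ g.2} | g.1 x ≤ g.2} := by
      ext x
      simp only [mem_insert_iff, forall_eq_or_imp, mem_ofPred_eq]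
      tauto
    rw [e]
    exact ih.inter_halfspace g.1 g.2

end Algebraic

section Euclidean

variable {E : Type*} [NormedAddCommGroup E] [InnerProductSpace ℝ E]

theorem IsPolytope.isClosed {K : Set E} (hK : IsPolytope K) : IsClosed K := by
  obtain ⟨V, hV, rfl⟩ := hK
  exact hV.isClosed_convexHull ℝ

theorem IsPolytope.convex {K : Set E} (hK : IsPolytope K) : Convex ℝ K := by
  obtain ⟨V, hV, rfl⟩ := hK
  exact convex_convexHull ℝ V

theorem IsPolyhedron.isClosed {P : Set E} (hP : IsPolyhedron P) : IsClosed P := by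
  obtain ⟨C, hC, hC', rfl⟩ := hP
  rw [sUnion_eq_biUnion]
  exact hC.isClosed_biUnion fun S hS => (hC' S hS).isClosed

variable [FiniteDimensional ℝ E]

/-- A polytope is a finite intersection of closed half-spaces. -/
theorem IsPolytope.exists_halfspaces {K : Set E} (hK : IsPolytope K) :
    ∃ G : Set ((E →ₗ[ℝ] ℝ) × ℝ), G.Finite ∧ ∀ x, x ∈ K ↔ ∀ g ∈ G, g.1 x ≤ g.2 := by
  obtain ⟨V, hV, rfl⟩ := hK
  -- Half-spaces are parametrised by a point of `E × ℝ`; those in a fixed simplex around `0`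
  -- that contain `V` form a polytope, and its vertices are the half-spaces looked for.
  obtain ⟨b, hb, -⟩ := exists_mem_interior_convexHull_affineBasis
    (E := E × ℝ) (s := univ) (x := 0) Filter.univ_mem
  let S : Set (E × ℝ) := convexHull ℝ (range b)
  have hS : IsPolytope S := ⟨range b, finite_range b, rfl⟩
  let ev : E → (E × ℝ →ₗ[ℝ] ℝ) := fun v =>
    (innerₗ E v).comp (LinearMap.fst ℝ E ℝ) - LinearMap.snd ℝ E ℝ
  have hev : ∀ v p, ev v p = inner ℝ v p.1 - p.2 := fun v p => rfl
  have hDpoly : IsPolytope {p ∈ S | ∀ g ∈ (fun v => (ev v, (0 : ℝ))) '' V, g.1 p ≤ g.2} :=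
    hS.inter_halfspaces (hV.image _)
  obtain ⟨W, hW, hDW⟩ := hDpoly
  refine ⟨(fun p : E × ℝ => (innerₗ E p.1, p.2)) '' W, hW.image _, fun x => ⟨?_, ?_⟩⟩
  · rintro hx g ⟨p, hp, rfl⟩
    have hpD := subset_convexHull ℝ W hp
    rw [← hDW] at hpD
    have hsub : convexHull ℝ V ⊆ {y | innerₗ E p.1 y ≤ p.2} := by
      refine convexHull_min (fun v hv => ?_) (convex_halfSpace_le (innerₗ E p.1).isLinear _)
      have h := hpD.2 _ ⟨v, hv, rfl⟩
      simp only [hev] at h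
      rw [real_inner_comm] at h
      simp only [mem_ofPred_eq, innerₗ_apply_apply]
      linarith
    exact hsub hx
  · intro hx
    by_contra hxV
    obtain ⟨φ, u, hφ, hux⟩ := geometric_hahn_banach_closed_point
      (convex_convexHull ℝ V) (hV.isClosed_convexHull ℝ) hxV
    let a : E := (InnerProductSpace.toDual ℝ E).symm φ
    have ha : ∀ y, inner ℝ a y = φ y := fun y => by
      simp [a, InnerProductSpace.toDual_symm_apply]
    have hT : Filter.Tendsto (fun t : ℝ => t • ((a, u) : E × ℝ)) (nhds 0) (nhds 0) := by
      have : Continuous (fun t : ℝ => t • ((a, u) : E × ℝ)) := by fun_prop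
      simpa using this.tendsto 0
    have hev1 : ∀ᶠ t : ℝ in nhds 0, t • ((a, u) : E × ℝ) ∈ S :=
      hT (mem_interior_iff_mem_nhds.1 hb)
    obtain ⟨ε, hε, hball⟩ := Metric.eventually_nhds_iff.1 hev1
    have htS : (ε / 2) • ((a, u) : E × ℝ) ∈ S := by
      apply hball
      rw [Real.dist_eq, sub_zero, abs_of_pos (by positivity)]
      linarith
    have hmem : (ε / 2) • ((a, u) : E × ℝ) ∈ convexHull ℝ W := by
      rw [← hDW]
      refine ⟨htS, ?_⟩
      rintro g ⟨v, hv, rfl⟩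
      have h := hφ v (subset_convexHull ℝ V hv)
      rw [map_smul, hev, real_inner_comm, ha, smul_eq_mul]
      exact mul_nonpos_of_nonneg_of_nonpos (by positivity) (by simp only; linarith)
    have hsub : convexHull ℝ W ⊆ {p | ev x p ≤ 0} := by
      refine convexHull_min (fun p hp => ?_) (convex_halfSpace_le (ev x).isLinear _)
      have h := hx _ ⟨p, hp, rfl⟩
      simp only [innerₗ_apply_apply] at h
      simp only [mem_ofPred_eq, hev]
      rw [real_inner_comm]
      linarith
    have h := hsub hmem
    simp only [mem_ofPred_eq] at h
    rw [map_smul, hev, real_inner_comm, ha, smul_eq_mul] at h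
    have : 0 < ε / 2 * (φ x - u) := mul_pos (by positivity) (by linarith)
    exact absurd h (not_le.2 this)

theorem IsPolytope.inter {K L : Set E} (hK : IsPolytope K) (hL : IsPolytope L) :
    IsPolytope (K ∩ L) := by
  obtain ⟨G, hG, hGL⟩ := hL.exists_halfspaces
  have h := hK.inter_halfspaces hG
  have e : K ∩ L = {x ∈ K | ∀ g ∈ G, g.1 x ≤ g.2} := by
    ext x
    simp [hGL]
  rwa [e]

theorem IsPolyhedron.inter {A B : Set E} (hA : IsPolyhedron A) (hB : IsPolyhedron B) :
    IsPolyhedron (A ∩ B) := by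
  obtain ⟨C, hC, hC', rfl⟩ := hA
  obtain ⟨D, hD, hD', rfl⟩ := hB
  have e : ⋃₀ C ∩ ⋃₀ D = ⋃ p ∈ C ×ˢ D, p.1 ∩ p.2 := by
    rw [sUnion_inter_sUnion]
  rw [e]
  exact IsPolyhedron.biUnion (hC.prod hD) fun p hp =>
    ((hC' _ hp.1).inter (hD' _ hp.2)).isPolyhedron

/-- The closure of a polytope cut by finitely many open half-spaces is a polytope. -/
theorem IsPolytope.closure_openHalfspaces {K : Set E} (hK : IsPolytope K)
    {G : Set ((E →ₗ[ℝ] ℝ) × ℝ)} (hG : G.Finite) :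
    IsPolytope (closure {x ∈ K | ∀ g ∈ G, g.2 < g.1 x}) := by
  rcases {x ∈ K | ∀ g ∈ G, g.2 < g.1 x}.eq_empty_or_nonempty with he | ⟨x₀, hx₀, hx₀G⟩
  · rw [he, closure_empty]
    exact isPolytope_empty
  have h := hK.inter_halfspaces (hG.image fun g => (-g.1, -g.2))
  have e : closure {x ∈ K | ∀ g ∈ G, g.2 < g.1 x}
      = {x ∈ K | ∀ g ∈ (fun g : (E →ₗ[ℝ] ℝ) × ℝ => (-g.1, -g.2)) '' G, g.1 x ≤ g.2} := by
    apply Subset.antisymm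
    · apply closure_minimal _ h.isClosed
      rintro x ⟨hx, hxG⟩
      refine ⟨hx, ?_⟩
      rintro g ⟨g', hg', rfl⟩
      have := hxG g' hg'
      simp only [LinearMap.neg_apply]
      linarith
    · rintro x ⟨hx, hxG⟩
      have hlim : Filter.Tendsto (fun t : ℝ => (1 - t) • x + t • x₀) (nhdsWithin 0 (Ioi 0))
          (nhds x) := by
        have hc : Continuous (fun t : ℝ => (1 - t) • x + t • x₀) := by fun_prop
        have := hc.tendsto 0
        simp only [sub_zero, one_smul, zero_smul, add_zero] at this
        exact this.mono_left nhdsWithin_le_nhds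
      refine mem_closure_of_tendsto hlim ?_
      have h01 : Ioo (0 : ℝ) 1 ∈ nhdsWithin (0 : ℝ) (Ioi 0) := Ioo_mem_nhdsGT one_pos
      filter_upwards [h01] with t ht
      refine ⟨hK.convex hx hx₀ (by linarith [ht.2]) ht.1.le (by ring), fun g hg => ?_⟩
      have h1 := hxG _ ⟨g, hg, rfl⟩
      have h2 := hx₀G g hg
      simp only [LinearMap.neg_apply, neg_le_neg_iff] at h1
      simp only [map_add, map_smul, smul_eq_mul]
      have h3 := mul_lt_mul_of_pos_left h2 ht.1
      have h4 := mul_le_mul_of_nonneg_left h1 (sub_nonneg.2 ht.2.le)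
      linarith
  rw [e]
  exact h

theorem closure_piece_diff {K : Set E} (hK : IsPolytope K) {D : Set (Set E)} (hD : D.Finite)
    (hD' : ∀ S ∈ D, IsPolytope S) : ∀ {G : Set ((E →ₗ[ℝ] ℝ) × ℝ)}, G.Finite →
      IsPolyhedron (closure ({x ∈ K | ∀ g ∈ G, g.2 < g.1 x} \ ⋃₀ D)) := by
  induction D, hD using Set.Finite.induction_on with
  | empty =>
    intro G hG
    rw [sUnion_empty, sdiff_empty]
    exact (hK.closure_openHalfspaces hG).isPolyhedron
  | @insert S D _ _ ih =>
    intro G hG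
    obtain ⟨G', hG', hS⟩ := (hD' S (mem_insert S D)).exists_halfspaces
    have e : {x ∈ K | ∀ g ∈ G, g.2 < g.1 x} \ ⋃₀ insert S D
        = ⋃ g' ∈ G', {x ∈ K | ∀ g ∈ insert g' G, g.2 < g.1 x} \ ⋃₀ D := by
      ext x
      simp only [sUnion_insert, mem_sdiff, mem_union, hS, mem_iUnion, mem_ofPred_eq,
        mem_insert_iff, forall_eq_or_imp, not_or, not_forall, not_le, exists_prop]
      constructor
      · rintro ⟨⟨h1, h2⟩, ⟨g', hg', h3⟩, h4⟩
        exact ⟨g', hg', ⟨h1, h3, h2⟩, h4⟩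
      · rintro ⟨g', hg', ⟨h1, h3, h2⟩, h4⟩
        exact ⟨⟨h1, h2⟩, ⟨g', hg', h3⟩, h4⟩
    rw [e, hG'.closure_biUnion]
    exact IsPolyhedron.biUnion hG' fun g' _ =>
      ih (fun T hT => hD' T (mem_insert_of_mem S hT)) (hG.insert g')

/-- The closure of the difference of two polyhedra is a polyhedron. -/
theorem IsPolyhedron.closure_diff {A B : Set E} (hA : IsPolyhedron A) (hB : IsPolyhedron B) :
    IsPolyhedron (closure (A \ B)) := by
  obtain ⟨C, hC, hC', rfl⟩ := hA
  obtain ⟨D, hD, hD', rfl⟩ := hB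
  have e : ⋃₀ C \ ⋃₀ D = ⋃ K ∈ C, K \ ⋃₀ D := by
    rw [sUnion_eq_biUnion]
    simp only [iUnion_sdiff]
  rw [e, hC.closure_biUnion]
  refine IsPolyhedron.biUnion hC fun K hK => ?_
  have h := closure_piece_diff (hC' K hK) hD hD' (G := ∅) finite_empty
  simpa using h

end Euclidean

/-! ### The Heyting algebra of open subpolyhedra -/

/-- Polyhedra in `ℝⁿ`. -/
def Polyhedron (n : ℕ) : Type := {P : Set (EuclideanSpace ℝ (Fin n)) // IsPolyhedron P}

/-- `SubO P` is the collection of open subpolyhedra of the polyhedron `P`: the subsets of `P`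
whose complement in `P` is a polyhedron. -/
def SubO {n : ℕ} (P : Polyhedron n) : Type :=
  {O : Set (EuclideanSpace ℝ (Fin n)) // O ⊆ P.1 ∧ IsPolyhedron (P.1 \ O)}

namespace SubO

variable {n : ℕ} {P : Polyhedron n}

/-- Open subpolyhedra are ordered by inclusion. -/
instance : PartialOrder (SubO P) := Subtype.partialOrder _

/-- The bounded distributive lattice of open subpolyhedra: joins are unions, meets are
intersections. -/
instance : DistribLattice (SubO P) where
  sup U V := ⟨U.1 ∪ V.1, union_subset U.2.1 V.2.1, by
    have e : P.1 \ (U.1 ∪ V.1) = (P.1 \ U.1) ∩ (P.1 \ V.1) := by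
      ext x
      simp only [mem_sdiff, mem_union, mem_inter_iff]
      tauto
    rw [e]
    exact U.2.2.inter V.2.2⟩
  inf U V := ⟨U.1 ∩ V.1, inter_subset_left.trans U.2.1, by
    rw [sdiff_inter]
    exact U.2.2.union V.2.2⟩
  le_sup_left U V := show U.1 ⊆ U.1 ∪ V.1 from subset_union_left
  le_sup_right U V := show V.1 ⊆ U.1 ∪ V.1 from subset_union_right
  sup_le U V W h₁ h₂ := show U.1 ∪ V.1 ⊆ W.1 from union_subset h₁ h₂
  inf_le_left U V := show U.1 ∩ V.1 ⊆ U.1 from inter_subset_left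
  inf_le_right U V := show U.1 ∩ V.1 ⊆ V.1 from inter_subset_right
  le_inf U V W h₁ h₂ := show U.1 ⊆ V.1 ∩ W.1 from subset_inter h₁ h₂
  le_sup_inf U V W := show (U.1 ∪ V.1) ∩ (U.1 ∪ W.1) ⊆ U.1 ∪ V.1 ∩ W.1 from
    (union_inter_distrib_left U.1 V.1 W.1).symm.subset

instance : BoundedOrder (SubO P) where
  top := ⟨P.1, Subset.rfl, by
    rw [sdiff_self]
    exact isPolyhedron_empty⟩
  le_top U := U.2.1
  bot := ⟨∅, empty_subset _, by
    rw [sdiff_empty]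
    exact P.2⟩
  bot_le U := empty_subset U.1

theorem closure_diff_subset (U V : SubO P) : closure (U.1 \ V.1) ⊆ P.1 :=
  closure_minimal (sdiff_subset.trans U.2.1) P.2.isClosed

/-- The Heyting implication of open subpolyhedra: the relative interior in `P` of
`(P \ U) ∪ V`, that is, `P` minus the closure of `U \ V`. -/
def imp (U V : SubO P) : SubO P :=
  ⟨P.1 \ closure (U.1 \ V.1), sdiff_subset, by
    rw [sdiff_sdiff_cancel_left (closure_diff_subset U V)]
    have e : U.1 \ V.1 = (P.1 \ V.1) \ (P.1 \ U.1) := by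
      ext x
      have := @U.2.1 x
      simp only [mem_sdiff]
      tauto
    rw [e]
    exact V.2.2.closure_diff U.2.2⟩

theorem le_imp_iff (U V W : SubO P) : U ≤ imp V W ↔ U ⊓ V ≤ W := by
  change U.1 ⊆ P.1 \ closure (V.1 \ W.1) ↔ U.1 ∩ V.1 ⊆ W.1
  constructor
  · rintro h x ⟨hxU, hxV⟩
    by_contra hxW
    exact (h hxU).2 (subset_closure ⟨hxV, hxW⟩)
  · intro h x hxU
    refine ⟨U.2.1 hxU, fun hx => ?_⟩
    have hsub : closure (V.1 \ W.1) ⊆ P.1 \ U.1 :=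
      closure_minimal (fun y hy => ⟨V.2.1 hy.1, fun hyU => hy.2 (h ⟨hyU, hy.1⟩)⟩)
        U.2.2.isClosed
    exact (hsub hx).2 hxU

/-- The Heyting algebra of open subpolyhedra of `P`. -/
instance : HeytingAlgebra (SubO P) := HeytingAlgebra.ofHImp imp le_imp_iff

end SubO

end OpenPolyhedra

/-!
Write `Cᵢ = P \ αᵢ` for a valuation `α` in `SubO P`. The complement in `P` of the value of `bd d` is
the set `B_d` given by `B_d = C_d ∩ closure (B_{d-1} \ C_d)`, starting from `B_{-1} = P`
(`sdiff_eval_bd_zero`, `sdiff_eval_bd_succ`). So `bd d = ⊤` holds under `α` iff `B_d` is empty, and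
the theorem follows from: some valuation makes `B_d` nonempty iff `P` contains a simplex of
dimension at least `d + 1` (`satisfies_bd_iff`).

* Passing from a polyhedron `A` to `C ∩ closure (A \ C)`, with `C` a polyhedron, lowers the
  dimension (`exists_simplex_of_simplex_subset_inter_closure_sdiff`). Indeed `A \ C` is a finite
  union of convex sets `Q`, so if a simplex with hull `T` lies in `C ∩ closure (A \ C)`, then by
  Baire's theorem the closure of one `Q` contains a nonempty relatively open subset `W` of `T`. If
  `Q` were contained in the affine span of `T`, it would meet `W ⊆ C`; it is disjoint from `C`, so
  the convex set `closure Q ⊆ A` has larger dimension than `T`. Hence a point of `B_d` produces a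
  simplex of dimension at least `d + 1` in `P`.
* Conversely, given a `(d + 1)`-simplex in `P`, take for `C₀, …, C_d` a decreasing flag of its faces
  of dimensions `d, …, 0`. As each face is in the closure of the difference to the next larger one,
  induction gives `C_i ⊆ B_i`, so the vertex `C_d` lies in `B_d`.
-/

namespace OpenPolyhedra

open Set Module

/-! ### Simplices in convex sets -/

section Simplices

variable {E : Type*} [NormedAddCommGroup E] [InnerProductSpace ℝ E]

theorem finrank_direction_affineSpan_simplex {k : ℕ} (σ : Affine.Simplex ℝ E k) :
    finrank ℝ (affineSpan ℝ (range σ.points)).direction = k := by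
  rw [direction_affineSpan]
  exact σ.independent.finrank_vectorSpan (Fintype.card_fin _)

variable [FiniteDimensional ℝ E]

/-- A nonempty convex set contains a simplex of the dimension of its affine span. -/
theorem exists_simplex_of_convex {K : Set E} (hK : Convex ℝ K) (hne : K.Nonempty) :
    ∃ σ : Affine.Simplex ℝ E (finrank ℝ (affineSpan ℝ K).direction),
      convexHull ℝ (range σ.points) ⊆ K := by
  obtain ⟨t, htK, hspan, hind⟩ := exists_affineIndependent ℝ E K
  have hfin : Finite t := finite_set_of_fin_dim_affineIndependent ℝ hind
  have : Fintype t := Fintype.ofFinite t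
  have htne : t.Nonempty := by
    rw [← affineSpan_nonempty ℝ, hspan, affineSpan_nonempty]
    exact hne
  have : Nonempty t := htne.to_subtype
  have hcard : Fintype.card t = finrank ℝ (affineSpan ℝ K).direction + 1 := by
    obtain ⟨m, hm⟩ := Nat.exists_eq_succ_of_ne_zero (Fintype.card_ne_zero (α := t))
    have h := hind.finrank_vectorSpan hm
    rw [Subtype.range_coe, ← direction_affineSpan, hspan] at h
    rw [h, hm]
  let e : Fin (finrank ℝ (affineSpan ℝ K).direction + 1) ≃ t := (Fintype.equivFinOfCardEq hcard).symm
  refine ⟨⟨fun i => (e i : E), hind.comp_embedding e.toEmbedding⟩, convexHull_min ?_ hK⟩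
  rintro _ ⟨i, rfl⟩
  exact htK (e i).2

/-! ### The dimension drop -/

/-- Baire's theorem for finitely many closed sets covering an open set. -/
theorem exists_inter_interior_nonempty {X : Type*} [TopologicalSpace X] [BaireSpace X]
    {F : Set (Set X)} (hF : F.Finite) (hc : ∀ K ∈ F, IsClosed K) {U : Set X} (hU : IsOpen U)
    (hne : U.Nonempty) (hcov : U ⊆ ⋃₀ F) : ∃ K ∈ F, (U ∩ interior K).Nonempty := by
  have hd := dense_sUnion_interior_of_closed (S := insert Uᶜ F)
    (by
      rintro s (rfl | hs)
      · exact hU.isClosed_compl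
      · exact hc s hs)
    (hF.insert _).countable
    (by
      refine eq_univ_of_forall fun x => ?_
      by_cases hx : x ∈ U
      · obtain ⟨K, hK, hxK⟩ := hcov hx
        exact ⟨K, Or.inr hK, hxK⟩
      · exact ⟨Uᶜ, Or.inl rfl, hx⟩)
  obtain ⟨x, hxU, hx⟩ := hd.inter_open_nonempty U hU hne
  simp only [mem_iUnion] at hx
  obtain ⟨K, rfl | hK, hxK⟩ := hx
  · exact absurd hxU (interior_subset hxK)
  · exact ⟨K, hK, x, hxU, hxK⟩

/-- A convex set minus finitely many polytopes is a finite union of convex sets. -/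
theorem exists_convex_sdiff_eq {K : Set E} (hK : Convex ℝ K) {D : Set (Set E)} (hD : D.Finite)
    (hD' : ∀ S ∈ D, IsPolytope S) :
    ∃ F : Set (Set E), F.Finite ∧ (∀ Q ∈ F, Convex ℝ Q) ∧ K \ ⋃₀ D = ⋃₀ F := by
  induction D, hD using Set.Finite.induction_on with
  | empty => exact ⟨{K}, finite_singleton K, by simpa using hK, by simp⟩
  | @insert S D _ _ ih =>
    obtain ⟨F, hF, hFc, hFe⟩ := ih fun T hT => hD' T (mem_insert_of_mem S hT)
    obtain ⟨G, hG, hS⟩ := (hD' S (mem_insert S D)).exists_halfspaces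
    refine ⟨(fun p : Set E × ((E →ₗ[ℝ] ℝ) × ℝ) => p.1 ∩ {x | p.2.2 < p.2.1 x}) '' (F ×ˢ G),
      (hF.prod hG).image _, ?_, ?_⟩
    · rintro _ ⟨⟨Q, g⟩, ⟨hQ, -⟩, rfl⟩
      exact (hFc Q hQ).inter (convex_halfSpace_gt g.1.isLinear _)
    · have e : K \ ⋃₀ insert S D = (⋃₀ F) \ S := by
        rw [← hFe, sUnion_insert, union_comm, ← sdiff_sdiff]
      rw [e]
      ext x
      simp only [mem_sdiff, mem_sUnion, hS, not_forall, not_le, mem_image, mem_prod, exists_prop]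
      constructor
      · rintro ⟨⟨Q, hQ, hxQ⟩, g, hg, hx⟩
        exact ⟨_, ⟨(Q, g), ⟨hQ, hg⟩, rfl⟩, hxQ, hx⟩
      · rintro ⟨_, ⟨⟨Q, g⟩, ⟨hQ, hg⟩, rfl⟩, hxQ, hx⟩
        exact ⟨⟨Q, hQ, hxQ⟩, g, hg, hx⟩

/-- The difference of two polyhedra is a finite union of convex sets. -/
theorem IsPolyhedron.exists_convex_sdiff_eq {A C : Set E} (hA : IsPolyhedron A)
    (hC : IsPolyhedron C) :
    ∃ F : Set (Set E), F.Finite ∧ (∀ Q ∈ F, Convex ℝ Q) ∧ A \ C = ⋃₀ F := by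
  obtain ⟨S, hS, hS', rfl⟩ := hA
  obtain ⟨D, hD, hD', rfl⟩ := hC
  have h := fun K hK => OpenPolyhedra.exists_convex_sdiff_eq (hS' K hK).convex hD hD'
  choose! F hF hFc hFe using h
  refine ⟨⋃ K ∈ S, F K, hS.biUnion hF, ?_, ?_⟩
  · intro Q hQ
    simp only [mem_iUnion] at hQ
    obtain ⟨K, hK, hQ⟩ := hQ
    exact hFc K hK Q hQ
  · rw [sUnion_eq_biUnion (s := S), sUnion_iUnion]
    simp only [iUnion_sdiff, sUnion_iUnion]
    exact iUnion₂_congr hFe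

/-- If `C ∩ closure (A \ C)` contains a `k`-simplex, then `A` contains a simplex of dimension
larger than `k`. -/
theorem exists_simplex_of_simplex_subset_inter_closure_sdiff {A C : Set E} (hA : IsPolyhedron A)
    (hC : IsPolyhedron C) {k : ℕ} (σ : Affine.Simplex ℝ E k)
    (hσ : convexHull ℝ (range σ.points) ⊆ C ∩ closure (A \ C)) :
    ∃ m, k < m ∧ ∃ τ : Affine.Simplex ℝ E m, convexHull ℝ (range τ.points) ⊆ A := by
  obtain ⟨F, hF, hFc, hFe⟩ := hA.exists_convex_sdiff_eq hC
  set T := convexHull ℝ (range σ.points) with hT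
  set L := affineSpan ℝ T with hL
  have hTne : T.Nonempty := (range_nonempty _).convexHull
  have hLfin : finrank ℝ L.direction = k := by
    rw [hL, hT, affineSpan_convexHull, finrank_direction_affineSpan_simplex]
  have hLne : Nonempty L := (hTne.mono (subset_affineSpan ℝ T)).to_subtype
  have hLclosed : IsClosed (L : Set E) := L.closed_of_finiteDimensional
  have : CompleteSpace L := hLclosed.completeSpace_coe
  let U : Set L := interior ((↑) ⁻¹' T)
  have hUne : U.Nonempty :=
    image_nonempty.1 ((intrinsicInterior_nonempty (convex_convexHull ℝ _)).2 hTne)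
  have hUT : ∀ x ∈ U, (x : E) ∈ T := fun x hx => interior_subset (s := ((↑) ⁻¹' T : Set L)) hx
  obtain ⟨_, ⟨Q, hQ, rfl⟩, hWne⟩ := exists_inter_interior_nonempty
    (F := (fun Q : Set E => ((↑) ⁻¹' closure Q : Set L)) '' F) (hF.image _)
    (by
      rintro _ ⟨Q, -, rfl⟩
      exact isClosed_closure.preimage continuous_subtype_val)
    isOpen_interior hUne
    (by
      intro x hx
      have h := (hσ (hUT x hx)).2
      rw [hFe, hF.closure_sUnion] at h
      simp only [mem_iUnion] at h
      obtain ⟨Q, hQ, hxQ⟩ := h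
      exact ⟨_, ⟨Q, hQ, rfl⟩, hxQ⟩)
  set W : Set L := U ∩ interior ((↑) ⁻¹' closure Q) with hW
  have hWo : IsOpen W := isOpen_interior.inter isOpen_interior
  have hWQ : ∀ x ∈ W, (x : E) ∈ closure Q := fun x hx =>
    interior_subset (s := ((↑) ⁻¹' closure Q : Set L)) hx.2
  have hQAC : Q ⊆ A \ C := hFe ▸ subset_sUnion_of_mem hQ
  have hQA : closure Q ⊆ A := closure_minimal (hQAC.trans sdiff_subset) hA.isClosed
  have hQL : ¬ Q ⊆ L := by
    intro hsub
    obtain ⟨O, hO, hOW⟩ := isOpen_induced_iff.1 hWo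
    obtain ⟨w, hw⟩ := hWne
    have hwO : (w : E) ∈ O := by
      rw [← hOW] at hw
      exact hw
    obtain ⟨q, hqO, hqQ⟩ := mem_closure_iff.1 (hWQ w hw) O hO hwO
    have hqW : (⟨q, hsub hqQ⟩ : L) ∈ W := by
      rw [← hOW]
      exact hqO
    exact (hQAC hqQ).2 (hσ (hUT _ hqW.1)).1
  have hLle : L ≤ affineSpan ℝ (closure Q) := by
    have h1 : (affineSpan ℝ W).map L.subtype = L := by
      rw [hWo.affineSpan_eq_top hWne]
      ext x
      simp
    rw [← h1, AffineSubspace.map_span]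
    refine affineSpan_mono ℝ ?_
    rintro _ ⟨x, hx, rfl⟩
    exact hWQ x hx
  have hlt : L < affineSpan ℝ (closure Q) :=
    lt_of_le_of_ne hLle fun h => hQL fun q hq => by
      rw [h]
      exact subset_affineSpan ℝ _ (subset_closure hq)
  have hdir := AffineSubspace.direction_lt_of_nonempty hlt (nonempty_coe_sort.1 hLne)
  have hQne : (closure Q).Nonempty := hWne.elim fun w hw => ⟨w, hWQ w hw⟩
  obtain ⟨τ, hτ⟩ := exists_simplex_of_convex (hFc Q hQ).closure hQne
  exact ⟨_, hLfin ▸ Submodule.finrank_lt_finrank_of_lt hdir, τ, hτ.trans hQA⟩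

end Simplices

/-! ### The flag of faces of a simplex -/

section Flag

variable {E : Type*} [NormedAddCommGroup E] [InnerProductSpace ℝ E]

/-- The face of a simplex spanned by the vertices with index at most `j`. -/
def initialFace {k : ℕ} (σ : Affine.Simplex ℝ E k) (j : ℕ) : Set E :=
  convexHull ℝ (σ.points '' {i | (i : ℕ) ≤ j})

theorem isPolyhedron_initialFace {k : ℕ} (σ : Affine.Simplex ℝ E k) (j : ℕ) :
    IsPolyhedron (initialFace σ j) :=
  IsPolytope.isPolyhedron ⟨_, (toFinite _).image _, rfl⟩

theorem initialFace_subset {k : ℕ} (σ : Affine.Simplex ℝ E k) (j : ℕ) :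
    initialFace σ j ⊆ convexHull ℝ (range σ.points) :=
  convexHull_mono (image_subset_range _ _)

theorem initialFace_nonempty {k : ℕ} (σ : Affine.Simplex ℝ E k) (j : ℕ) :
    (initialFace σ j).Nonempty :=
  ⟨σ.points 0, subset_convexHull ℝ _ ⟨0, by simp, rfl⟩⟩

theorem initialFace_subset_closure_sdiff {k : ℕ} (σ : Affine.Simplex ℝ E k) {j : ℕ} (hj : j < k) :
    initialFace σ j ⊆ closure (initialFace σ (j + 1) \ initialFace σ j) := by
  intro x hx
  let v : E := σ.points ⟨j + 1, by lia⟩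
  have hv : v ∉ affineSpan ℝ (σ.points '' {i | (i : ℕ) ≤ j}) := by
    intro h
    have h' := (σ.independent.mem_affineSpan_iff _ _).1 h
    simp at h'
  -- The points of the segment from `x` to the next vertex `v`, other than `x`, leave the face.
  have hlim : Filter.Tendsto (fun t : ℝ => AffineMap.lineMap x v t) (nhdsWithin 0 (Ioi 0))
      (nhds x) := by
    have hc : Continuous (fun t : ℝ => AffineMap.lineMap x v t) := AffineMap.lineMap_continuous
    have := hc.tendsto 0
    rw [AffineMap.lineMap_apply_zero] at this
    exact this.mono_left nhdsWithin_le_nhds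
  refine mem_closure_of_tendsto hlim ?_
  filter_upwards [Ioo_mem_nhdsGT (one_pos (α := ℝ))] with t ht
  have hxA := convexHull_subset_affineSpan _ hx
  refine ⟨?_, fun h => hv ?_⟩
  · refine (convex_convexHull ℝ _).lineMap_mem ?_ ?_ ⟨ht.1.le, ht.2.le⟩
    · exact convexHull_mono (image_mono fun i hi => Nat.le_succ_of_le hi) hx
    · exact subset_convexHull ℝ _ ⟨⟨j + 1, by lia⟩, Nat.le_refl (j + 1), rfl⟩
  · have h2 := AffineMap.lineMap_mem t⁻¹ hxA (convexHull_subset_affineSpan _ h)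
    rwa [AffineMap.lineMap_lineMap_right, inv_mul_cancel₀ ht.1.ne',
      AffineMap.lineMap_apply_one] at h2

end Flag

/-! ### The bounded-depth formulas in the algebra of open subpolyhedra -/

section Eval

variable {n : ℕ} {P : Polyhedron n}

/-- The complement of `U ∨ (U → W)` in `P`. -/
theorem sdiff_sup_himp (U W : SubO P) :
    P.1 \ (U ⊔ (U ⇨ W)).1 = (P.1 \ U.1) ∩ closure ((P.1 \ W.1) \ (P.1 \ U.1)) := by
  have e : (P.1 \ W.1) \ (P.1 \ U.1) = U.1 \ W.1 := by
    ext x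
    have := @U.2.1 x
    simp only [mem_sdiff]
    tauto
  change P.1 \ (U.1 ∪ P.1 \ closure (U.1 \ W.1)) = _
  rw [e]
  ext x
  simp only [mem_sdiff, mem_union, mem_inter_iff]
  tauto

theorem sdiff_eval_bd_zero (v : ℕ → SubO P) :
    P.1 \ ((Formula.bd 0).eval v).1
      = (P.1 \ (v 0).1) ∩ closure (P.1 \ (P.1 \ (v 0).1)) := by
  have h := sdiff_sup_himp (v 0) ⊥
  rw [show (⊥ : SubO P).1 = ∅ from rfl, sdiff_empty] at h
  exact h

theorem sdiff_eval_bd_succ (v : ℕ → SubO P) (d : ℕ) :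
    P.1 \ ((Formula.bd (d + 1)).eval v).1
      = (P.1 \ (v (d + 1)).1) ∩
        closure ((P.1 \ ((Formula.bd d).eval v).1) \ (P.1 \ (v (d + 1)).1)) :=
  sdiff_sup_himp _ _

/-- A simplex in the complement of the value of `bd d` witnesses a simplex of dimension larger by
at least `d + 1` in the polyhedron. -/
theorem exists_simplex_of_simplex_subset_sdiff_eval_bd (v : ℕ → SubO P) (d : ℕ) :
    ∀ {k : ℕ} (σ : Affine.Simplex ℝ (EuclideanSpace ℝ (Fin n)) k),
      convexHull ℝ (range σ.points) ⊆ P.1 \ ((Formula.bd d).eval v).1 →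
      ∃ m, k + d < m ∧ ∃ τ : Affine.Simplex ℝ (EuclideanSpace ℝ (Fin n)) m,
        convexHull ℝ (range τ.points) ⊆ P.1 := by
  induction d with
  | zero =>
    intro k σ hσ
    rw [sdiff_eval_bd_zero] at hσ
    exact exists_simplex_of_simplex_subset_inter_closure_sdiff P.2 (v 0).2.2 σ hσ
  | succ d ih =>
    intro k σ hσ
    rw [sdiff_eval_bd_succ] at hσ
    obtain ⟨m, hm, τ, hτ⟩ := exists_simplex_of_simplex_subset_inter_closure_sdiff
      ((Formula.bd d).eval v).2.2 (v (d + 1)).2.2 σ hσ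
    obtain ⟨m', hm', τ', hτ'⟩ := ih τ hτ
    exact ⟨m', by lia, τ', hτ'⟩

theorem not_satisfies_bd_of_simplex {d m : ℕ} (hdm : d < m)
    (σ : Affine.Simplex ℝ (EuclideanSpace ℝ (Fin n)) m)
    (hσ : convexHull ℝ (range σ.points) ⊆ P.1) : ¬ Satisfies (SubO P) (Formula.bd d) := by
  intro hsat
  have hsub : ∀ j, initialFace σ j ⊆ P.1 := fun j => (initialFace_subset σ j).trans hσ
  have hcompl : ∀ j, P.1 \ (P.1 \ initialFace σ j) = initialFace σ j := fun j =>
    sdiff_sdiff_cancel_left (hsub j)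
  let v : ℕ → SubO P := fun i => ⟨P.1 \ initialFace σ (d - i), sdiff_subset, by
    rw [hcompl]
    exact isPolyhedron_initialFace σ _⟩
  have hv : ∀ i, P.1 \ (v i).1 = initialFace σ (d - i) := fun i => hcompl _
  have key : ∀ i ≤ d, initialFace σ (d - i) ⊆ P.1 \ ((Formula.bd i).eval v).1 := by
    intro i
    induction i with
    | zero =>
      intro _
      rw [sdiff_eval_bd_zero, hv]
      exact subset_inter Subset.rfl ((initialFace_subset_closure_sdiff σ (by lia)).trans
        (closure_mono (sdiff_subset_sdiff_left (hsub _))))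
    | succ i ih =>
      intro hi
      rw [sdiff_eval_bd_succ, hv]
      refine subset_inter Subset.rfl ((initialFace_subset_closure_sdiff σ (by lia)).trans
        (closure_mono (sdiff_subset_sdiff_left ?_)))
      rw [show d - (i + 1) + 1 = d - i by lia]
      exact ih (by lia)
  obtain ⟨x, hx⟩ := initialFace_nonempty σ (d - d)
  have h := key d le_rfl hx
  rw [hsat v] at h
  exact h.2 h.1

theorem satisfies_bd_iff (d : ℕ) :
    Satisfies (SubO P) (Formula.bd d) ↔ polyDim P.1 ≤ ((d : ℕ∞) : WithBot ℕ∞) := by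
  rw [polyDim, iSup₂_le_iff]
  constructor
  · rintro h m ⟨σ, hσ⟩
    by_contra hm
    exact not_satisfies_bd_of_simplex (by simpa using hm) σ hσ h
  · intro h v
    by_contra hne
    have hx : ∃ x, x ∈ P.1 \ ((Formula.bd d).eval v).1 := by
      by_contra! hx
      refine hne (top_le_iff.1 fun x hxP => ?_)
      by_contra hxv
      exact hx x ⟨hxP, hxv⟩
    obtain ⟨x, hx⟩ := hx
    obtain ⟨m, hm, τ, hτ⟩ := exists_simplex_of_simplex_subset_sdiff_eval_bd v d
      (Affine.Simplex.mkOfPoint ℝ x) (by simpa using hx)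
    have := h m ⟨τ, hτ⟩
    simp only [Nat.cast_le, WithBot.coe_le_coe] at this
    lia

theorem polyDim_nonneg (hP : P.1.Nonempty) : 0 ≤ polyDim P.1 := by
  obtain ⟨x, hx⟩ := hP
  exact le_iSup₂_of_le (f := fun (k : ℕ) _ => ((k : ℕ∞) : WithBot ℕ∞)) 0
    ⟨Affine.Simplex.mkOfPoint ℝ x, by simpa using hx⟩ (by simp)

end Eval

end OpenPolyhedra

theorem theorem4p1 (n : ℕ) (P : OpenPolyhedra.Polyhedron n) (hP : P.1.Nonempty) (d : ℕ) :
    OpenPolyhedra.polyDim P.1 = ((d : ℕ∞) : WithBot ℕ∞) ↔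
      (OpenPolyhedra.Satisfies (OpenPolyhedra.SubO P) (OpenPolyhedra.Formula.bd d) ∧
        ∀ d' : ℕ, d' < d →
          ¬ OpenPolyhedra.Satisfies (OpenPolyhedra.SubO P) (OpenPolyhedra.Formula.bd d')) := by
  simp only [OpenPolyhedra.satisfies_bd_iff]
  have h0 := OpenPolyhedra.polyDim_nonneg hP
  generalize OpenPolyhedra.polyDim P.1 = δ at h0 ⊢
  constructor
  · rintro rfl
    refine ⟨le_rfl, fun d' hd' h => ?_⟩
    simp only [Nat.cast_le, WithBot.coe_le_coe] at h
    lia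
  · rintro ⟨h1, h2⟩
    cases δ with
    | bot => simp at h0
    | coe δ =>
      have hδ : δ ≤ d := WithBot.coe_le_coe.1 h1
      lift δ to ℕ using ne_top_of_le_ne_top (ENat.natCast_ne_top d) hδ
      by_contra hne
      refine h2 δ (lt_of_le_of_ne (by simpa using hδ) ?_) le_rfl
      rintro rfl
      exact hne rfl
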